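/- **Theorem 5.** Let $S=\{s_1,\dots,s_d\}$ ($d\ge 1$) be a finite set, $\Omega=S^{\infty}$, and let $\alpha\in(0,1)$. A DGP is a probability measure $P$ on $\Omega$ under which the coordinates are independent, but not necessarily identically distributed; $P_i$ is its marginal on the $i$-th coordinate, $P^{N}$ its marginal on the coordinates after the $N$-th, and $\bar P_N=N^{-1}\sum_{i=1}^N P_i$. Let $\mathcal P$ be a weak*-compact set of DGPs with full support such that for every $P\in\mathcal P$ the probabilities $P_i(s)$ are bounded away from zero uniformly in $i\ge 1$ and $s\in S$: $\inf_{i,s}P_i(s)>0$. For $s\in S$ let $\mathbf x(s)\in\mathbb R^{d-1}$ be $e_j$ if $s=s_j$ with $j\le d-1$, and $0$ if $s=s_d$. For a sample $\omega_N=(\omega_1,\dots,\omega_N)$ put $\bar{\mathbf X}_N=N^{-1}\sum_{i=1}^N\mathbf x(\omega_i)$. For a distribution $p$ on $S$ with full support let $\mu(p)=(p(s_k))_{k\le d-1}$, let $\Sigma(p)$ be the $(d-1)\times(d-1)$ matrix with entries $p(s_k)(1-p(s_k))$ on the diagonal and $-p(s_k)p(s_l)$ off it, and let $$E_{N,\alpha}(p^{\infty})=\Big\{\omega_N:\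 N\,(\bar{\mathbf X}_N-\mu(p))^{T}\,\Sigma(p)^{-1}\,(\bar{\mathbf X}_N-\mu(p))\le\chi^2_{d-1}(\alpha)\Big\},$$ where $\chi^2_{d-1}(\alpha)$ is the upper $\alpha$-quantile of the chi-square distribution with $d-1$ degrees of freedom (so $E_{N,\alpha}(p^\infty)$ is the region cut out by the $1-\alpha$ probability contour of the approximating Gaussian distribution). The robust i.i.d. statistical tests define the updated sets $$\mathcal P(\omega_N)=\{P\in\mathcal P:\ \omega_N\in E_{N,\alpha}((\bar P_N)^{\infty})\}.$$ Then the i.i.d. tests have asymptotic level $1-\alpha$, i.e. $\liminf_{N\to\infty}p^{\infty}(E_{N,\alpha}(p^{\infty}))\ge 1-\alpha$ for every distribution $p$ on $S$ with full support; and the updated sets accommodate the truth with the same asymptotic level: for every $P^*\in\mathcal P$, $$\liminf_{N\to\infty}P^{*}\big(\{\omega_N:\ P^{*N}\in \mathrm{co}(\{P^{N}:P\in\mathcal P(\omega_N)\})\}\big)\ge 1-\alpha,$$ where $\mathrm{co}$ denotes the closed convex hull in the weak* topology. -/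

import Mathlib

open MeasureTheory ProbabilityTheory Filter
open scoped ENNReal NNReal Matrix

noncomputable section

/-- The state space `Ω = S^∞`: infinite sequences of outcomes in the finite set
`S = {s_1, …, s_d}`, with `d = k + 1` and `S = Fin (k + 1)`. Experiments are indexed from `0`, so
the sample of size `N` consists of the experiments `0, …, N - 1`. The topology is the product of
the discrete ones and the sigma-algebra is the product of the discrete ones. -/
abbrev StateSpace (k : ℕ) : Type := ℕ → Fin (k + 1)

/-- Sample data of size `N`. -/
abbrev SampleSpace (k N : ℕ) : Type := Fin N → Fin (k + 1)

variable {k : ℕ}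

/-- The first `N` outcomes of a state. -/
def samplePart (N : ℕ) (ω : StateSpace k) : SampleSpace k N := fun i => ω i

/-- The outcomes of a state after the first `N` ones, as a sequence. -/
def futurePart (N : ℕ) (ω : StateSpace k) : StateSpace k := fun i => ω (N + i)

theorem measurable_futurePart (N : ℕ) : Measurable (futurePart (k := k) N) :=
  measurable_pi_lambda _ fun i => measurable_pi_apply (N + i)

/-- Independence across experiments: the coordinates are mutually independent under `P`. -/
def IsIndependentDGP (P : ProbabilityMeasure (StateSpace k)) : Prop :=
  iIndepFun (fun (i : ℕ) (ω : StateSpace k) => ω i) (P : Measure (StateSpace k))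

/-- An initial set of DGPs: a (weak*-)compact set of independent, possibly non-identical
distributions with full support. -/
structure IsInitialSet (𝒟 : Set (ProbabilityMeasure (StateSpace k))) : Prop where
  isCompact : IsCompact 𝒟
  independent : ∀ P ∈ 𝒟, IsIndependentDGP P
  fullSupport : ∀ P ∈ 𝒟, (P : Measure (StateSpace k)).IsOpenPosMeasure

/-- The marginal distribution `P_i` over the `i`-th experiment. -/
def marginal (P : Measure (StateSpace k)) (i : ℕ) : Measure (Fin (k + 1)) :=
  P.map fun ω => ω i

/-- The marginal `P^N` over the future experiments. -/
def futureMarginal (N : ℕ) (P : ProbabilityMeasure (StateSpace k)) :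
    ProbabilityMeasure (StateSpace k) :=
  P.map (measurable_futurePart N).aemeasurable

/-- The average of sample marginals `N⁻¹ ∑_{i < N} P_i`, a distribution over outcomes
(for `N ≥ 1`). -/
def avgMarginal (P : Measure (StateSpace k)) (N : ℕ) : Measure (Fin (k + 1)) :=
  (N : ℝ≥0∞)⁻¹ • ∑ i ∈ Finset.range N, marginal P i

/-- The i.i.d. distribution `p^∞` over states with marginal `p`. -/
def iidDGP (p : Measure (Fin (k + 1))) : Measure (StateSpace k) :=
  Measure.infinitePi fun _ : ℕ => p

/-- The vector in `ℝ^{d-1}` that encodes an outcome: `e_s` for the first `d - 1 = k` outcomes, and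
`0` for the last one. -/
def outcomeVec (s : Fin (k + 1)) : Fin k → ℝ := fun a => if s = a.castSucc then 1 else 0

/-- Mean of the encoded outcome of an experiment with outcome distribution `p`. -/
def meanVec (p : Measure (Fin (k + 1))) : Fin k → ℝ := fun a => p.real {a.castSucc}

/-- Covariance matrix of the encoded outcome of an experiment with outcome distribution `p`. -/
def covMat (p : Measure (Fin (k + 1))) : Matrix (Fin k) (Fin k) ℝ := Matrix.of fun a b =>
  if a = b then p.real {a.castSucc} * (1 - p.real {a.castSucc})
  else -(p.real {a.castSucc} * p.real {b.castSucc})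

/-- Average over the sample of the mean vectors under `P`. -/
def avgMean (P : Measure (StateSpace k)) (N : ℕ) : Fin k → ℝ :=
  (N : ℝ)⁻¹ • ∑ i ∈ Finset.range N, meanVec (marginal P i)

/-- Average over the sample of the covariance matrices under `P`. -/
def avgCov (P : Measure (StateSpace k)) (N : ℕ) : Matrix (Fin k) (Fin k) ℝ :=
  (N : ℝ)⁻¹ • ∑ i ∈ Finset.range N, covMat (marginal P i)

/-- The average of the encoded sample data. -/
def sampleMean {N : ℕ} (x : SampleSpace k N) : Fin k → ℝ :=
  (N : ℝ)⁻¹ • ∑ i, outcomeVec (x i)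

/-- The chi-square distribution with `n` degrees of freedom: the law of the sum of squares of `n`
independent standard normal variables. -/
def chiSquare (n : ℕ) : Measure ℝ :=
  (Measure.pi fun _ : Fin n => gaussianReal 0 1).map fun z => ∑ i, z i ^ 2

/-- The upper `α`-quantile of the chi-square distribution, for `0 < α < 1`. -/
def chiSquareUpperQuantile (n : ℕ) (α : ℝ) : ℝ :=
  sInf {c : ℝ | ENNReal.ofReal (1 - α) ≤ chiSquare n (Set.Iic c)}

/-- The region of acceptance `E_{N,α}(P)` for testing `P`, by normal approximation: the sample
average lies inside the probability contour of content `1 - α` of the Gaussian distribution with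
mean `avgMean P N` and covariance matrix `N⁻¹ avgCov P N`, those of the sample average under `P`. -/
def acceptanceRegion (N : ℕ) (α : ℝ) (P : Measure (StateSpace k)) : Set (SampleSpace k N) :=
  {x | (N : ℝ) * ((sampleMean x - avgMean P N) ⬝ᵥ
      ((avgCov P N)⁻¹ *ᵥ (sampleMean x - avgMean P N))) ≤ chiSquareUpperQuantile k α}

/-- The updated set given by the robust i.i.d. statistical tests with asymptotic level `1 - α`. -/
def robustUpdatedSet (𝒟 : Set (ProbabilityMeasure (StateSpace k))) (α : ℝ) (N : ℕ)
    (x : SampleSpace k N) : Set (ProbabilityMeasure (StateSpace k)) :=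
  {P | P ∈ 𝒟 ∧ x ∈ acceptanceRegion N α (iidDGP (avgMarginal (P : Measure (StateSpace k)) N))}

/-- A set of DGPs accommodates `P` (after a sample of size `N`) if `P^N` belongs to the closed
convex hull of the marginals over future experiments of its members. The hull is taken in the space
of finite measures with the weak topology, in which the probability measures form a closed convex
subset. -/
def Accommodates (N : ℕ) (𝒬 : Set (ProbabilityMeasure (StateSpace k)))
    (P : ProbabilityMeasure (StateSpace k)) : Prop :=
  (futureMarginal N P).toFiniteMeasure ∈
    closure (convexHull ℝ≥0 ((fun Q => (futureMarginal N Q).toFiniteMeasure) '' 𝒬))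

/-- A family of updated sets, one for each sample, accommodates the truth with asymptotic
level `1 - α` for the initial set `𝒟`. -/
def AccommodatesTruthWithLevel (𝒟 : Set (ProbabilityMeasure (StateSpace k)))
    (updated : (N : ℕ) → SampleSpace k N → Set (ProbabilityMeasure (StateSpace k)))
    (α : ℝ) : Prop :=
  ∀ P ∈ 𝒟, ENNReal.ofReal (1 - α) ≤
    liminf (fun N : ℕ => (P : Measure (StateSpace k))
      {ω | Accommodates N (updated N (samplePart N ω)) P}) atTop

end

/-! Two facts carry the proof. The first is a central limit theorem for independent, non-identical
outcomes: under the truth `P`, the region built from the actual mean and covariance of the sample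
average has probability tending to the chi-square mass of `Iic q`, `q` the upper quantile, which is
at least `1 - α` (`tendsto_measure_acceptanceRegion`). The average covariance need not converge, so
the sample mean is first whitened by a matrix `B N` with `B N * avgCov P N * (B N)ᵀ = 1`; its
characteristic function then tends to the standard Gaussian one.

The second compares `P` with the i.i.d. law of its average marginal. Both give the sample average
the same mean, but the covariance of a mixture is the average covariance plus the dispersion of the
means. The i.i.d. covariance is therefore larger, its inverse smaller, and the i.i.d. region
contains the one for `P` (`acceptanceRegion_subset_avgMarginal`). Whenever the sample falls in the
latter, `P` itself survives the test, so its future marginal lies in the hull. -/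

/-! ### Characteristic functions of sums of small independent variables. -/

theorem norm_prod_sub_prod_le_sum {ι : Type*} (s : Finset ι) (a b : ι → ℂ)
    (ha : ∀ i ∈ s, ‖a i‖ ≤ 1) (hb : ∀ i ∈ s, ‖b i‖ ≤ 1) :
    ‖∏ i ∈ s, a i - ∏ i ∈ s, b i‖ ≤ ∑ i ∈ s, ‖a i - b i‖ := by
  classical
  induction s using Finset.induction_on with
  | empty => simp
  | insert j s hj ih =>
    rw [Finset.prod_insert hj, Finset.prod_insert hj, Finset.sum_insert hj]
    have hA : ‖∏ i ∈ s, a i‖ ≤ 1 := by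
      rw [norm_prod]
      exact Finset.prod_le_one (fun _ _ => norm_nonneg _)
        fun i hi => ha i (Finset.mem_insert_of_mem hi)
    have hB := hb j (Finset.mem_insert_self _ _)
    have ih' := ih (fun i hi => ha i (Finset.mem_insert_of_mem hi))
      fun i hi => hb i (Finset.mem_insert_of_mem hi)
    calc ‖a j * ∏ i ∈ s, a i - b j * ∏ i ∈ s, b i‖
        = ‖(a j - b j) * ∏ i ∈ s, a i + b j * (∏ i ∈ s, a i - ∏ i ∈ s, b i)‖ := by ring_nf
      _ ≤ ‖a j - b j‖ * ‖∏ i ∈ s, a i‖ + ‖b j‖ * ‖∏ i ∈ s, a i - ∏ i ∈ s, b i‖ := by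
        refine (norm_add_le _ _).trans ?_
        rw [norm_mul, norm_mul]
      _ ≤ ‖a j - b j‖ * 1 + 1 * ∑ i ∈ s, ‖a i - b i‖ := by gcongr
      _ = _ := by ring

theorem norm_cexp_mul_I_sub_taylor_le {x b : ℝ} (hx : |x| ≤ b) (hb : b ≤ 1) :
    ‖Complex.exp (x * Complex.I) - (1 + x * Complex.I - x ^ 2 / 2)‖ ≤ 3 * b ^ 3 := by
  have h := Complex.norm_exp_sub_sum_le_norm_mul_exp (x * Complex.I) 3
  have e : ∑ m ∈ Finset.range 3, ((x : ℂ) * Complex.I) ^ m / (m.factorial : ℂ)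
      = 1 + x * Complex.I - x ^ 2 / 2 := by
    simp [Finset.sum_range_succ, mul_pow, Nat.factorial]
    ring
  rw [e] at h
  have hn : ‖(x : ℂ) * Complex.I‖ = |x| := by simp
  rw [hn] at h
  have he : Real.exp |x| ≤ 3 :=
    (Real.exp_le_exp.2 (hx.trans hb)).trans (Real.exp_one_lt_d9.le.trans (by norm_num))
  calc _ ≤ |x| ^ 3 * Real.exp |x| := h
    _ ≤ b ^ 3 * 3 := by
      have hb0 : 0 ≤ b := (abs_nonneg x).trans hx
      gcongr
    _ = _ := by ring

theorem norm_cexp_neg_half_sub_taylor_le {v b : ℝ} (hv0 : 0 ≤ v) (hv : v ≤ b ^ 2) (hb0 : 0 ≤ b)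
    (hb : b ≤ 1) : ‖(1 - (v : ℂ) / 2) - Complex.exp (-(v : ℂ) / 2)‖ ≤ b ^ 3 := by
  have h := Complex.norm_exp_sub_sum_le_norm_mul_exp (-(v : ℂ) / 2) 2
  have e : ∑ m ∈ Finset.range 2, (-(v : ℂ) / 2) ^ m / (m.factorial : ℂ) = 1 - (v : ℂ) / 2 := by
    simp [Finset.sum_range_succ]
    ring
  rw [e, norm_sub_rev] at h
  have hn : ‖-(v : ℂ) / 2‖ = v / 2 := by simp [abs_of_nonneg hv0]
  rw [hn] at h
  have hb2 : b ^ 2 ≤ 1 := pow_le_one₀ hb0 hb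
  have he : Real.exp (v / 2) ≤ 3 :=
    (Real.exp_le_exp.2 (by linarith)).trans (Real.exp_one_lt_d9.le.trans (by norm_num))
  calc _ ≤ (v / 2) ^ 2 * Real.exp (v / 2) := h
    _ ≤ (b ^ 2 / 2) ^ 2 * 3 := by gcongr
    _ = b ^ 3 * (b * (3 / 4)) := by ring
    _ ≤ b ^ 3 * 1 := by gcongr; linarith
    _ = _ := by ring

section Lindeberg

variable {Ω : Type*} [MeasurableSpace Ω] {P : Measure Ω} [IsProbabilityMeasure P]

/-- Both terms agree with `1 - v / 2`, `v` the variance, up to third order in `b`; the constant is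
`3 + 1` from the two Taylor estimates. -/
theorem norm_integral_cexp_sub_gaussian_le {X : Ω → ℝ} (hX : Measurable X) {b : ℝ} (hb0 : 0 ≤ b)
    (hb : b ≤ 1) (hbd : ∀ ω, |X ω| ≤ b) (hmean : ∫ ω, X ω ∂P = 0) :
    ‖∫ ω, Complex.exp (X ω * Complex.I) ∂P -
      Complex.exp (-((∫ ω, X ω ^ 2 ∂P : ℝ) : ℂ) / 2)‖ ≤ 4 * b ^ 3 := by
  set v := ∫ ω, X ω ^ 2 ∂P with hv
  have hX1 : Integrable X P := .of_bound hX.aestronglyMeasurable b (.of_forall hbd)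
  have hsq : ∀ ω, X ω ^ 2 ≤ b ^ 2 := fun ω => sq_le_sq' (abs_le.1 (hbd ω)).1 (abs_le.1 (hbd ω)).2
  have hX2 : Integrable (fun ω => X ω ^ 2) P :=
    .of_bound (hX.pow_const 2).aestronglyMeasurable (b ^ 2)
      (.of_forall fun ω => by simpa using hsq ω)
  have hv0 : 0 ≤ v := integral_nonneg fun ω => sq_nonneg _
  have hvb : v ≤ b ^ 2 := by
    have := integral_mono hX2 (integrable_const (b ^ 2)) hsq
    simpa using this
  have hE : Integrable (fun ω => Complex.exp (X ω * Complex.I)) P :=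
    .of_bound (by fun_prop) 1 (.of_forall fun ω => by simp)
  have hXc : Integrable (fun ω => (X ω : ℂ) * Complex.I) P := hX1.ofReal.mul_const _
  have hX2c : Integrable (fun ω => (X ω : ℂ) ^ 2 / 2) P := by
    have := (hX2.ofReal (𝕜 := ℂ)).div_const 2
    simpa using this
  have hT : Integrable (fun ω => (1 : ℂ) + X ω * Complex.I - X ω ^ 2 / 2) P :=
    ((integrable_const _).add hXc).sub hX2c
  have hTint : ∫ ω, ((1 : ℂ) + X ω * Complex.I - X ω ^ 2 / 2) ∂P = 1 - (v : ℂ) / 2 := by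
    have h1 : ∫ ω, (X ω : ℂ) * Complex.I ∂P = 0 := by
      rw [integral_mul_const, integral_complex_ofReal, hmean]; simp
    have h2 : ∫ ω, (X ω : ℂ) ^ 2 / 2 ∂P = (v : ℂ) / 2 := by
      rw [integral_div, hv, ← integral_complex_ofReal]; simp
    have h3 : ∫ ω, ((1 : ℂ) + X ω * Complex.I) ∂P = 1 := by
      rw [integral_add (integrable_const _) hXc, h1]
      simp
    rw [← h2]
    exact (integral_sub ((integrable_const _).add hXc) hX2c).trans (congrArg (· - _) h3)
  have h1 : ‖∫ ω, Complex.exp (X ω * Complex.I) ∂P - (1 - (v : ℂ) / 2)‖ ≤ 3 * b ^ 3 := by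
    rw [← hTint, ← integral_sub hE hT]
    have := norm_integral_le_of_norm_le_const (μ := P)
      (.of_forall fun ω => norm_cexp_mul_I_sub_taylor_le (hbd ω) hb)
    simpa using this
  have h2 := norm_cexp_neg_half_sub_taylor_le hv0 hvb hb0 hb
  calc _ ≤ _ + _ := norm_sub_le_norm_sub_add_norm_sub _ (1 - (v : ℂ) / 2) _
    _ ≤ 3 * b ^ 3 + b ^ 3 := add_le_add h1 h2
    _ = _ := by ring

/-- Independence turns both sides into products of factors in the unit disc, so the errors add. For
`b` of order `1 / √N` the bound is of order `1 / √N`. -/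
theorem norm_integral_cexp_sum_sub_gaussian_le {N : ℕ} {X : Fin N → Ω → ℝ}
    (hindep : iIndepFun X P) (hX : ∀ i, Measurable (X i)) {b : ℝ} (hb0 : 0 ≤ b) (hb : b ≤ 1)
    (hbd : ∀ i ω, |X i ω| ≤ b) (hmean : ∀ i, ∫ ω, X i ω ∂P = 0) :
    ‖∫ ω, Complex.exp ((∑ i, X i ω : ℝ) * Complex.I) ∂P -
      Complex.exp (-((∑ i, ∫ ω, X i ω ^ 2 ∂P : ℝ) : ℂ) / 2)‖ ≤ N * (4 * b ^ 3) := by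
  have e1 : ∫ ω, Complex.exp ((∑ i, X i ω : ℝ) * Complex.I) ∂P
      = ∏ i, ∫ ω, Complex.exp (X i ω * Complex.I) ∂P := by
    rw [← hindep.integral_fun_prod_comp (f := fun _ x => Complex.exp ((x : ℝ) * Complex.I))
      (fun i => (hX i).aemeasurable) (fun i => by fun_prop)]
    congr with ω
    rw [← Complex.exp_sum, Complex.ofReal_sum, Finset.sum_mul]
  have e2 : Complex.exp (-((∑ i, ∫ ω, X i ω ^ 2 ∂P : ℝ) : ℂ) / 2)
      = ∏ i, Complex.exp (-((∫ ω, X i ω ^ 2 ∂P : ℝ) : ℂ) / 2) := by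
    rw [← Complex.exp_sum, Complex.ofReal_sum, ← Finset.sum_neg_distrib, Finset.sum_div]
  rw [e1, e2]
  refine (norm_prod_sub_prod_le_sum _ _ _ (fun i _ => ?_) fun i _ => ?_).trans ?_
  · have := norm_integral_le_of_norm_le_const (μ := P) (C := 1)
      (f := fun ω => Complex.exp (X i ω * Complex.I)) (.of_forall fun ω => by simp)
    simpa using this
  · have h0 : 0 ≤ ∫ ω, X i ω ^ 2 ∂P := integral_nonneg fun ω => sq_nonneg _
    rw [Complex.norm_exp, Real.exp_le_one_iff]
    have : (-((∫ ω, X i ω ^ 2 ∂P : ℝ) : ℂ) / 2).re = -(∫ ω, X i ω ^ 2 ∂P) / 2 := by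
      simp
    rw [this]
    linarith
  · refine (Finset.sum_le_sum fun i _ =>
      norm_integral_cexp_sub_gaussian_le (hX i) hb0 hb (hbd i) (hmean i)).trans ?_
    simp

end Lindeberg

/-! ### The chi-square quantile and balls under the standard Gaussian. -/

/-- Right continuity of the cdf carries the inequality from points above the infimum to the infimum
itself. -/
theorem le_cdf_sInf (μ : Measure ℝ) {p : ℝ} (hp1 : p < 1) :
    p ≤ cdf μ (sInf {c | p ≤ cdf μ c}) := by
  set A := {c | p ≤ cdf μ c} with hA
  have hne : A.Nonempty := ((tendsto_cdf_atTop μ).eventually (eventually_ge_nhds hp1)).exists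
  have hmono : ∀ {x}, sInf A < x → p ≤ cdf μ x := fun hx => by
    obtain ⟨c, hc, hcx⟩ := exists_lt_of_csInf_lt hne hx
    exact le_trans hc ((cdf μ).mono hcx.le)
  have hr := ((cdf μ).right_continuous (sInf A)).mono Set.Ioi_subset_Ici_self
  exact ge_of_tendsto hr.tendsto (eventually_nhdsWithin_of_forall fun x hx => hmono hx)

theorem isProbabilityMeasure_chiSquare (n : ℕ) : IsProbabilityMeasure (chiSquare n) :=
  
  Measure.isProbabilityMeasure_map
    (Finset.measurable_fun_sum _ fun i _ => (measurable_pi_apply i).pow_const 2).aemeasurable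

theorem le_chiSquare_Iic_quantile (n : ℕ) {α : ℝ} (hα : 0 < α) :
    ENNReal.ofReal (1 - α) ≤ chiSquare n (Set.Iic (chiSquareUpperQuantile n α)) := by
  have := isProbabilityMeasure_chiSquare n
  have h (c : ℝ) : ENNReal.ofReal (1 - α) ≤ chiSquare n (Set.Iic c) ↔
      1 - α ≤ cdf (chiSquare n) c := by
    rw [cdf_eq_real, Measure.real, ENNReal.ofReal_le_iff_le_toReal (measure_ne_top _ _)]
  rw [h]
  simp only [chiSquareUpperQuantile, h]
  exact le_cdf_sInf _ (by linarith)

theorem MeasureTheory.Measure.AbsolutelyContinuous.pi_fin {n : ℕ} {μ ν : Fin n → Measure ℝ}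
    [∀ i, SigmaFinite (μ i)] [∀ i, SigmaFinite (ν i)] (h : ∀ i, μ i ≪ ν i) :
    Measure.pi μ ≪ Measure.pi ν := by
  induction n with
  | zero => rw [Measure.pi_of_empty, Measure.pi_of_empty]
  | succ n ih =>
    have hμ := (measurePreserving_piFinSuccAbove μ 0).symm
    have hν := (measurePreserving_piFinSuccAbove ν 0).symm
    rw [← hμ.map_eq, ← hν.map_eq]
    exact ((h 0).prod (ih fun i => h _)).map (MeasurableEquiv.measurable _)

theorem stdGaussian_absolutelyContinuous (n : ℕ) :
    stdGaussian (EuclideanSpace ℝ (Fin n)) ≪ volume := by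
  rw [← map_pi_eq_stdGaussian, ← (PiLp.volume_preserving_toLp (Fin n)).map_eq]
  exact (Measure.AbsolutelyContinuous.pi_fin fun _ =>
    gaussianReal_absolutelyContinuous 0 one_ne_zero).map (by fun_prop)

/-- A convex set has Lebesgue-null boundary. This makes the ball a continuity set for weak
convergence. -/
theorem stdGaussian_frontier_norm_sq_le (n : ℕ) (q : ℝ) :
    stdGaussian (EuclideanSpace ℝ (Fin n)) (frontier {z | ‖z‖ ^ 2 ≤ q}) = 0 := by
  refine stdGaussian_absolutelyContinuous n (Convex.addHaar_frontier volume ?_)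
  have h : ConvexOn ℝ Set.univ fun z : EuclideanSpace ℝ (Fin n) => ‖z‖ ^ 2 :=
    (convexOn_norm convex_univ).pow (fun _ _ => norm_nonneg _) 2
  simpa using h.convex_le q

theorem stdGaussian_norm_sq_le (n : ℕ) (q : ℝ) :
    stdGaussian (EuclideanSpace ℝ (Fin n)) {z | ‖z‖ ^ 2 ≤ q} = chiSquare n (Set.Iic q) := by
  rw [← map_pi_eq_stdGaussian, chiSquare,
    Measure.map_apply (by fun_prop) (measurableSet_le (by fun_prop) measurable_const),
    Measure.map_apply
      (Finset.measurable_fun_sum _ fun i _ => (measurable_pi_apply i).pow_const 2) measurableSet_Iic]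
  congr 1
  ext z
  simp [EuclideanSpace.norm_sq_eq]

/-! ### Covariance matrices as quadratic forms. -/

section QuadraticForms

variable {k : ℕ}

theorem covMat_quadForm (p : Measure (Fin (k + 1))) (u : Fin k → ℝ) :
    u ⬝ᵥ (covMat p *ᵥ u) = ∑ a, meanVec p a * u a ^ 2 - (meanVec p ⬝ᵥ u) ^ 2 := by
  have h : covMat p = Matrix.diagonal (meanVec p) - Matrix.vecMulVec (meanVec p) (meanVec p) := by
    ext a b
    by_cases hab : a = b
    · subst hab
      simp [covMat, meanVec, Matrix.vecMulVec_apply]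
      ring
    · simp [covMat, meanVec, Matrix.vecMulVec_apply, hab]
  rw [h, Matrix.sub_mulVec, dotProduct_sub, Matrix.vecMulVec_mulVec, dotProduct_smul,
    dotProduct_comm u (meanVec p)]
  simp [dotProduct, Matrix.mulVec_diagonal, pow_two]
  exact Finset.sum_congr rfl fun a _ => by ring

theorem sum_meanVec_add_last (p : Measure (Fin (k + 1))) [IsProbabilityMeasure p] :
    ∑ a, meanVec p a + p.real {Fin.last k} = 1 := by
  have : ∑ s, p.real {s} = 1 := by
    simp
  rw [Fin.sum_univ_castSucc] at this
  exact this

/-- Cauchy–Schwarz with weights `meanVec p a` leaves the factor `1 - ∑ a, meanVec p a`, the mass of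
the last outcome. One `c` comes from that mass, the other from the weights. -/
theorem le_covMat_quadForm (p : Measure (Fin (k + 1))) [IsProbabilityMeasure p] {c : ℝ}
    (hc : 0 < c) (hp : ∀ s, c ≤ p.real {s}) (u : Fin k → ℝ) :
    c ^ 2 * (u ⬝ᵥ u) ≤ u ⬝ᵥ (covMat p *ᵥ u) := by
  rw [covMat_quadForm]
  have hm : ∀ a, c ≤ meanVec p a := fun a => hp _
  have hcs : (meanVec p ⬝ᵥ u) ^ 2 ≤ (∑ a, meanVec p a) * ∑ a, meanVec p a * u a ^ 2 :=
    Finset.sum_sq_le_sum_mul_sum_of_sq_le_mul _ (fun a _ => hc.le.trans (hm a))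
      (fun a _ => mul_nonneg (hc.le.trans (hm a)) (sq_nonneg _)) fun a _ => le_of_eq (by ring)
  have hs := sum_meanVec_add_last p
  have hlow : c * (u ⬝ᵥ u) ≤ ∑ a, meanVec p a * u a ^ 2 := by
    rw [dotProduct, Finset.mul_sum]
    refine Finset.sum_le_sum fun a _ => ?_
    rw [← pow_two]
    exact mul_le_mul_of_nonneg_right (hm a) (sq_nonneg _)
  have hu : 0 ≤ u ⬝ᵥ u := Finset.sum_nonneg fun a _ => mul_self_nonneg _
  have hl := hp (Fin.last k)
  calc c ^ 2 * (u ⬝ᵥ u) = c * (c * (u ⬝ᵥ u)) := by ring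
    _ ≤ p.real {Fin.last k} * ∑ a, meanVec p a * u a ^ 2 := by gcongr
    _ = (1 - ∑ a, meanVec p a) * ∑ a, meanVec p a * u a ^ 2 := by rw [← hs]; ring
    _ ≤ _ := by linarith

theorem isHermitian_covMat (p : Measure (Fin (k + 1))) : (covMat p).IsHermitian := by
  ext a b
  by_cases hab : a = b
  · simp [hab]
  · simp [covMat, hab, Ne.symm hab, mul_comm]

theorem avgCov_quadForm (P : Measure (StateSpace k)) (N : ℕ) (u : Fin k → ℝ) :
    u ⬝ᵥ (avgCov P N *ᵥ u) =
      (N : ℝ)⁻¹ * ∑ i ∈ Finset.range N, u ⬝ᵥ (covMat (marginal P i) *ᵥ u) := by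
  rw [avgCov, Matrix.smul_mulVec, dotProduct_smul, Matrix.sum_mulVec, dotProduct_sum, smul_eq_mul]

theorem isHermitian_avgCov (P : Measure (StateSpace k)) (N : ℕ) : (avgCov P N).IsHermitian := by
  rw [avgCov, Matrix.IsHermitian, Matrix.conjTranspose_smul, Matrix.conjTranspose_sum]
  simp_rw [(isHermitian_covMat _).eq, star_trivial]

theorem isProbabilityMeasure_marginal (P : Measure (StateSpace k)) [IsProbabilityMeasure P]
    (i : ℕ) : IsProbabilityMeasure (marginal P i) :=
  Measure.isProbabilityMeasure_map (measurable_pi_apply i).aemeasurable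

theorem le_avgCov_quadForm (P : Measure (StateSpace k)) [IsProbabilityMeasure P] {c : ℝ}
    (hc : 0 < c) (hP : ∀ i s, c ≤ (marginal P i).real {s}) {N : ℕ} (hN : N ≠ 0) (u : Fin k → ℝ) :
    c ^ 2 * (u ⬝ᵥ u) ≤ u ⬝ᵥ (avgCov P N *ᵥ u) := by
  have hN' : (0 : ℝ) < N := by positivity
  rw [avgCov_quadForm, le_inv_mul_iff₀ hN', ← nsmul_eq_mul]
  conv_lhs => rw [← Finset.card_range N, ← Finset.sum_const]
  exact Finset.sum_le_sum fun i _ =>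
    have := isProbabilityMeasure_marginal P i
    le_covMat_quadForm _ hc (hP i) u

theorem posDef_of_le_quadForm {A : Matrix (Fin k) (Fin k) ℝ} (hA : A.IsHermitian) {c : ℝ}
    (hc : 0 < c) (h : ∀ u : Fin k → ℝ, c * (u ⬝ᵥ u) ≤ u ⬝ᵥ (A *ᵥ u)) : A.PosDef := by
  refine .of_dotProduct_mulVec_pos hA fun u hu => ?_
  have : 0 < u ⬝ᵥ u := by
    refine lt_of_le_of_ne (Finset.sum_nonneg fun a _ => mul_self_nonneg _) ?_
    exact fun h0 => hu (dotProduct_self_eq_zero.1 h0.symm)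
  exact (mul_pos hc this).trans_le (h u)

/-- Inversion of positive definite matrices is antitone, on quadratic forms. -/
theorem inv_quadForm_antitone {A C : Matrix (Fin k) (Fin k) ℝ} (hA : A.PosDef) (hC : C.PosDef)
    (h : ∀ u : Fin k → ℝ, u ⬝ᵥ (C *ᵥ u) ≤ u ⬝ᵥ (A *ᵥ u)) (y : Fin k → ℝ) :
    y ⬝ᵥ (A⁻¹ *ᵥ y) ≤ y ⬝ᵥ (C⁻¹ *ᵥ y) := by
  set w := A⁻¹ *ᵥ y with hw
  have hAu : IsUnit A.det := (Matrix.isUnit_iff_isUnit_det A).1 hA.isUnit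
  have hCu : IsUnit C.det := (Matrix.isUnit_iff_isUnit_det C).1 hC.isUnit
  have hAw : A *ᵥ w = y := by
    rw [hw, Matrix.mulVec_mulVec, Matrix.mul_nonsing_inv _ hAu, Matrix.one_mulVec]
  -- Completing the square: this expands to `y·C⁻¹y - 2 w·y + w·Cw`, while `w·Cw ≤ w·Aw = w·y =
  -- y·A⁻¹y`.
  have h0 : 0 ≤ (y - C *ᵥ w) ⬝ᵥ (C⁻¹ *ᵥ (y - C *ᵥ w)) := by
    simpa using hC.inv.posSemidef.dotProduct_mulVec_nonneg (y - C *ᵥ w)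
  have hCt : Cᵀ = C := by simpa using hC.isHermitian.eq
  have e1 : C⁻¹ *ᵥ (y - C *ᵥ w) = C⁻¹ *ᵥ y - w := by
    rw [Matrix.mulVec_sub, Matrix.mulVec_mulVec, Matrix.nonsing_inv_mul _ hCu, Matrix.one_mulVec]
  have e2 : (C *ᵥ w) ⬝ᵥ (C⁻¹ *ᵥ y) = w ⬝ᵥ y := by
    rw [dotProduct_comm, Matrix.dotProduct_mulVec, ← Matrix.mulVec_transpose, hCt,
      Matrix.mulVec_mulVec, Matrix.mul_nonsing_inv _ hCu, Matrix.one_mulVec, dotProduct_comm]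
  rw [e1, sub_dotProduct, dotProduct_sub, dotProduct_sub, e2, dotProduct_comm (C *ᵥ w) w] at h0
  have h1 := h w
  rw [hAw] at h1
  rw [dotProduct_comm w y] at *
  linarith

open scoped MatrixOrder in
-- `B` is the whitening matrix: it turns covariance `C` into the identity and the test statistic
-- into a squared Euclidean norm.
theorem exists_inv_eq_transpose_mul_self {C : Matrix (Fin k) (Fin k) ℝ} (hC : C.PosDef) :
    ∃ B : Matrix (Fin k) (Fin k) ℝ, C⁻¹ = Bᵀ * B ∧ B * C * Bᵀ = 1 := by
  obtain ⟨B, hB⟩ := CStarAlgebra.nonneg_iff_eq_star_mul_self.1 hC.inv.posSemidef.nonneg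
  have hB' : C⁻¹ = Bᵀ * B := by
    rw [hB, Matrix.star_eq_conjTranspose, Matrix.conjTranspose_eq_transpose_of_trivial]
  refine ⟨B, hB', ?_⟩
  have hCu : IsUnit C.det := (Matrix.isUnit_iff_isUnit_det C).1 hC.isUnit
  have h1 : (C * Bᵀ) * B = 1 := by
    rw [Matrix.mul_assoc, ← hB', Matrix.mul_nonsing_inv _ hCu]
  rw [Matrix.mul_assoc]
  exact mul_eq_one_comm.1 h1

end QuadraticForms

/-! ### Comparison of a DGP with the i.i.d. law of its average marginal. -/

section AverageMarginal

variable {k : ℕ}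

theorem isProbabilityMeasure_avgMarginal (P : Measure (StateSpace k)) [IsProbabilityMeasure P]
    {N : ℕ} (hN : N ≠ 0) : IsProbabilityMeasure (avgMarginal P N) := by
  constructor
  have : ∀ i, marginal P i Set.univ = 1 := fun i =>
    (isProbabilityMeasure_marginal P i).measure_univ
  simp only [avgMarginal, Measure.smul_apply, Measure.coe_finsetSum, Finset.sum_apply, this,
    Finset.sum_const, Finset.card_range, smul_eq_mul, nsmul_eq_mul, mul_one]
  exact ENNReal.inv_mul_cancel (by simpa using hN) (by simp)

theorem avgMarginal_real (P : Measure (StateSpace k)) [IsProbabilityMeasure P] (N : ℕ)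
    (A : Set (Fin (k + 1))) : (avgMarginal P N).real A =
      (N : ℝ)⁻¹ * ∑ i ∈ Finset.range N, (marginal P i).real A := by
  have := fun i => isProbabilityMeasure_marginal P i
  simp only [avgMarginal, Measure.real, Measure.smul_apply, Measure.coe_finsetSum,
    Finset.sum_apply, smul_eq_mul, ENNReal.toReal_mul, ENNReal.toReal_inv, ENNReal.toReal_natCast]
  rw [ENNReal.toReal_sum fun i _ => measure_ne_top _ _]

theorem meanVec_avgMarginal (P : Measure (StateSpace k)) [IsProbabilityMeasure P] (N : ℕ) :
    meanVec (avgMarginal P N) = avgMean P N := by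
  ext a
  simp [meanVec, avgMean, avgMarginal_real]

/-- The second moments average linearly, so the gap is the variance over `i` of `meanVec (marginal P
i) ⬝ᵥ u`, nonnegative by Cauchy–Schwarz. -/
theorem avgCov_le_covMat_avgMarginal (P : Measure (StateSpace k)) [IsProbabilityMeasure P]
    {N : ℕ} (hN : N ≠ 0) (u : Fin k → ℝ) :
    u ⬝ᵥ (avgCov P N *ᵥ u) ≤ u ⬝ᵥ (covMat (avgMarginal P N) *ᵥ u) := by
  have hN' : (0 : ℝ) < N := by positivity
  rw [avgCov_quadForm, covMat_quadForm, meanVec_avgMarginal]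
  simp_rw [covMat_quadForm]
  have e1 : ∑ a, avgMean P N a * u a ^ 2 =
      (N : ℝ)⁻¹ * ∑ i ∈ Finset.range N, ∑ a, meanVec (marginal P i) a * u a ^ 2 := by
    rw [Finset.sum_comm, Finset.mul_sum]
    refine Finset.sum_congr rfl fun a _ => ?_
    simp [avgMean, Finset.sum_mul, mul_assoc]
  have e2 : avgMean P N ⬝ᵥ u =
      (N : ℝ)⁻¹ * ∑ i ∈ Finset.range N, meanVec (marginal P i) ⬝ᵥ u := by
    rw [avgMean, smul_dotProduct, sum_dotProduct, smul_eq_mul]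
  rw [e1, e2, Finset.sum_sub_distrib, mul_sub]
  have hcs := sq_sum_le_card_mul_sum_sq (s := Finset.range N)
    (f := fun i => meanVec (marginal P i) ⬝ᵥ u)
  rw [Finset.card_range] at hcs
  have : ((N : ℝ)⁻¹ * ∑ i ∈ Finset.range N, meanVec (marginal P i) ⬝ᵥ u) ^ 2 ≤
      (N : ℝ)⁻¹ * ∑ i ∈ Finset.range N, (meanVec (marginal P i) ⬝ᵥ u) ^ 2 := by
    calc _ = ((N : ℝ)⁻¹) ^ 2 * (∑ i ∈ Finset.range N, meanVec (marginal P i) ⬝ᵥ u) ^ 2 := by ring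
      _ ≤ ((N : ℝ)⁻¹) ^ 2 * (N * ∑ i ∈ Finset.range N, (meanVec (marginal P i) ⬝ᵥ u) ^ 2) := by
        gcongr
      _ = _ := by field_simp
  linarith

theorem marginal_iidDGP (p : Measure (Fin (k + 1))) [IsProbabilityMeasure p] (i : ℕ) :
    marginal (iidDGP p) i = p :=
  (measurePreserving_eval_infinitePi (fun _ : ℕ => p) i).map_eq

theorem avgMean_iidDGP (p : Measure (Fin (k + 1))) [IsProbabilityMeasure p] {N : ℕ}
    (hN : N ≠ 0) : avgMean (iidDGP p) N = meanVec p := by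
  ext a
  simp [avgMean, marginal_iidDGP, hN]

theorem avgCov_iidDGP (p : Measure (Fin (k + 1))) [IsProbabilityMeasure p] {N : ℕ}
    (hN : N ≠ 0) : avgCov (iidDGP p) N = covMat p := by
  have hN' : (N : ℝ) ≠ 0 := by exact_mod_cast hN
  simp_rw [avgCov, marginal_iidDGP, Finset.sum_const, Finset.card_range]
  rw [← Nat.cast_smul_eq_nsmul ℝ, inv_smul_smul₀ hN']

theorem acceptanceRegion_subset_avgMarginal (P : Measure (StateSpace k)) [IsProbabilityMeasure P]
    {c : ℝ} (hc : 0 < c) (hP : ∀ i s, c ≤ (marginal P i).real {s}) {N : ℕ} (hN : N ≠ 0) (α : ℝ) :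
    acceptanceRegion N α P ⊆ acceptanceRegion N α (iidDGP (avgMarginal P N)) := by
  have := isProbabilityMeasure_avgMarginal P hN
  have hC : (avgCov P N).PosDef :=
    posDef_of_le_quadForm (isHermitian_avgCov P N) (by positivity)
      fun u => le_avgCov_quadForm P hc hP hN u
  have hA : (covMat (avgMarginal P N)).PosDef :=
    posDef_of_le_quadForm (isHermitian_covMat _) (c := c ^ 2) (by positivity) fun u =>
      (le_avgCov_quadForm P hc hP hN u).trans (avgCov_le_covMat_avgMarginal P hN u)
  intro x hx
  rw [acceptanceRegion, Set.mem_ofPred_eq] at hx ⊢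
  rw [avgMean_iidDGP _ hN, avgCov_iidDGP _ hN, meanVec_avgMarginal]
  refine le_trans (mul_le_mul_of_nonneg_left ?_ (Nat.cast_nonneg N)) hx
  exact inv_quadForm_antitone hA hC (avgCov_le_covMat_avgMarginal P hN) _

end AverageMarginal

/-! ### Central limit theorem for the whitened sample mean. -/

section CentralLimit

variable {k : ℕ}

/-- The `u`-component of the centered encoded outcome of the `i`-th experiment. -/
noncomputable def centeredComponent (P : Measure (StateSpace k)) (u : Fin k → ℝ) (i : ℕ)
    (s : Fin (k + 1)) : ℝ :=
  u ⬝ᵥ (outcomeVec s - meanVec (marginal P i))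

theorem dotProduct_outcomeVec_castSucc (u : Fin k → ℝ) (a : Fin k) :
    u ⬝ᵥ outcomeVec a.castSucc = u a := by
  simp [outcomeVec, dotProduct]

theorem dotProduct_outcomeVec_last (u : Fin k → ℝ) :
    u ⬝ᵥ outcomeVec (Fin.last k) = 0 := by
  simp [outcomeVec, dotProduct, (Fin.castSucc_lt_last _).ne']

theorem integral_comp_coord (P : Measure (StateSpace k)) [IsProbabilityMeasure P] (i : ℕ)
    (f : Fin (k + 1) → ℝ) :
    ∫ ω, f (ω i) ∂P = ∑ a : Fin k, meanVec (marginal P i) a * f a.castSucc +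
      (marginal P i).real {Fin.last k} * f (Fin.last k) := by
  have := isProbabilityMeasure_marginal P i
  rw [← integral_map (φ := fun ω : StateSpace k => ω i) (f := f)
    (measurable_pi_apply i).aemeasurable (measurable_of_finite f).aestronglyMeasurable]
  change ∫ s, f s ∂(marginal P i) = _
  rw [integral_fintype (.of_finite), Fin.sum_univ_castSucc]
  simp [meanVec]

theorem integral_centeredComponent (P : Measure (StateSpace k)) [IsProbabilityMeasure P]
    (u : Fin k → ℝ) (i : ℕ) : ∫ ω, centeredComponent P u i (ω i) ∂P = 0 := by
  have := isProbabilityMeasure_marginal P i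
  have hs := sum_meanVec_add_last (marginal P i)
  rw [integral_comp_coord]
  simp only [centeredComponent, dotProduct_sub, dotProduct_outcomeVec_castSucc,
    dotProduct_outcomeVec_last, mul_sub, Finset.sum_sub_distrib, ← Finset.sum_mul]
  rw [dotProduct_comm u]
  change meanVec (marginal P i) ⬝ᵥ u - _ + _ = 0
  linear_combination (-(meanVec (marginal P i) ⬝ᵥ u)) * hs

theorem integral_centeredComponent_sq (P : Measure (StateSpace k)) [IsProbabilityMeasure P]
    (u : Fin k → ℝ) (i : ℕ) :
    ∫ ω, centeredComponent P u i (ω i) ^ 2 ∂P = u ⬝ᵥ (covMat (marginal P i) *ᵥ u) := by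
  have := isProbabilityMeasure_marginal P i
  have hs := sum_meanVec_add_last (marginal P i)
  rw [integral_comp_coord P i fun s => centeredComponent P u i s ^ 2, covMat_quadForm]
  simp only [centeredComponent, dotProduct_sub, dotProduct_outcomeVec_castSucc,
    dotProduct_outcomeVec_last]
  rw [dotProduct_comm u]
  set m := meanVec (marginal P i) ⬝ᵥ u with hm
  have e : ∑ a, meanVec (marginal P i) a * (u a - m) ^ 2 =
      ∑ a, meanVec (marginal P i) a * u a ^ 2 - 2 * m * m
        + (∑ a, meanVec (marginal P i) a) * m ^ 2 := by
    conv_rhs => enter [1, 2, 2]; rw [hm, dotProduct]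
    rw [Finset.mul_sum, ← Finset.sum_sub_distrib, Finset.sum_mul, ← Finset.sum_add_distrib]
    exact Finset.sum_congr rfl fun a _ => by ring
  rw [e]
  linear_combination m ^ 2 * hs

theorem abs_centeredComponent_le (P : Measure (StateSpace k)) [IsProbabilityMeasure P]
    (u : Fin k → ℝ) (i : ℕ) (s : Fin (k + 1)) : |centeredComponent P u i s| ≤ ∑ a, |u a| := by
  have := isProbabilityMeasure_marginal P i
  rw [centeredComponent, dotProduct]
  refine (Finset.abs_sum_le_sum_abs _ _).trans (Finset.sum_le_sum fun a _ => ?_)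
  rw [abs_mul]
  refine mul_le_of_le_one_right (abs_nonneg _) ?_
  have h0 : 0 ≤ meanVec (marginal P i) a := measureReal_nonneg
  have h1 : meanVec (marginal P i) a ≤ 1 := measureReal_le_one
  rw [Pi.sub_apply, abs_le, outcomeVec]
  split_ifs <;> constructor <;> linarith

theorem dotProduct_sampleMean_sub_avgMean (P : Measure (StateSpace k)) (u : Fin k → ℝ) (N : ℕ)
    (ω : StateSpace k) : u ⬝ᵥ (sampleMean (samplePart N ω) - avgMean P N) =
      (N : ℝ)⁻¹ * ∑ i : Fin N, centeredComponent P u i (ω i) := by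
  have h : sampleMean (samplePart N ω) - avgMean P N =
      (N : ℝ)⁻¹ • ∑ i : Fin N, (outcomeVec (ω i) - meanVec (marginal P i)) := by
    rw [sampleMean, avgMean, Finset.sum_range, ← smul_sub, ← Finset.sum_sub_distrib]
    rfl
  rw [h, dotProduct_smul, dotProduct_sum, smul_eq_mul]
  rfl

/-- The sample average, centered, scaled by `√N` and transformed by `B`. -/
noncomputable def normalizedSampleMean (P : Measure (StateSpace k)) (B : Matrix (Fin k) (Fin k) ℝ)
    (N : ℕ) (ω : StateSpace k) : EuclideanSpace ℝ (Fin k) :=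
  WithLp.toLp 2 (√N • (B *ᵥ (sampleMean (samplePart N ω) - avgMean P N)))

theorem measurable_normalizedSampleMean (P : Measure (StateSpace k))
    (B : Matrix (Fin k) (Fin k) ℝ) (N : ℕ) : Measurable (normalizedSampleMean P B N) := by
  have h : Measurable fun x : SampleSpace k N =>
      (WithLp.toLp 2 (√N • (B *ᵥ (sampleMean x - avgMean P N))) : EuclideanSpace ℝ (Fin k)) :=
    measurable_of_finite _
  exact h.comp (measurable_pi_lambda _ fun i => measurable_pi_apply _)

theorem inner_normalizedSampleMean (P : Measure (StateSpace k)) (B : Matrix (Fin k) (Fin k) ℝ)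
    (N : ℕ) (ω : StateSpace k) (t : EuclideanSpace ℝ (Fin k)) :
    inner ℝ (normalizedSampleMean P B N ω) t =
      ∑ i : Fin N, (√N)⁻¹ * centeredComponent P (Bᵀ *ᵥ t.ofLp) i (ω i) := by
  rw [EuclideanSpace.inner_eq_star_dotProduct, star_trivial, normalizedSampleMean,
    dotProduct_smul, Matrix.dotProduct_mulVec, ← Matrix.mulVec_transpose,
    dotProduct_sampleMean_sub_avgMean, smul_eq_mul, ← mul_assoc, ← Finset.mul_sum]
  congr 1
  rw [← div_eq_mul_inv, Real.sqrt_div_self', one_div]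

theorem norm_sq_normalizedSampleMean (P : Measure (StateSpace k)) (B : Matrix (Fin k) (Fin k) ℝ)
    (N : ℕ) (ω : StateSpace k) : ‖normalizedSampleMean P B N ω‖ ^ 2 =
      N * ((sampleMean (samplePart N ω) - avgMean P N) ⬝ᵥ
        ((Bᵀ * B) *ᵥ (sampleMean (samplePart N ω) - avgMean P N))) := by
  rw [← real_inner_self_eq_norm_sq, EuclideanSpace.inner_eq_star_dotProduct, star_trivial,
    normalizedSampleMean, dotProduct_smul, smul_dotProduct, smul_smul,
    Real.mul_self_sqrt (Nat.cast_nonneg N), smul_eq_mul, ← Matrix.mulVec_mulVec,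
    Matrix.dotProduct_mulVec _ Bᵀ, Matrix.vecMul_transpose]

theorem norm_charFun_normalizedSampleMean_sub_le {P : Measure (StateSpace k)}
    [IsProbabilityMeasure P] (hindep : iIndepFun (fun (i : ℕ) (ω : StateSpace k) => ω i) P)
    {c : ℝ} (hc : 0 < c) (hP : ∀ i s, c ≤ (marginal P i).real {s}) {N : ℕ} (hN : N ≠ 0)
    {B : Matrix (Fin k) (Fin k) ℝ} (hB : B * avgCov P N * Bᵀ = 1) (t : EuclideanSpace ℝ (Fin k))
    (hNt : k * (‖t‖ / c) / √N ≤ 1) :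
    ‖charFun (P.map (normalizedSampleMean P B N)) t - Complex.exp (-‖t‖ ^ 2 / 2)‖ ≤
      4 * (k * (‖t‖ / c)) ^ 3 * (√N)⁻¹ := by
  have hN' : (0 : ℝ) < N := by positivity
  set u := Bᵀ *ᵥ t.ofLp with hu
  have hut : u ⬝ᵥ (avgCov P N *ᵥ u) = ‖t‖ ^ 2 := by
    have e : u ⬝ᵥ (avgCov P N *ᵥ u) = t.ofLp ⬝ᵥ ((B * avgCov P N * Bᵀ) *ᵥ t.ofLp) := by
      conv_lhs => enter [1]; rw [hu, Matrix.mulVec_transpose]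
      rw [← Matrix.dotProduct_mulVec, hu, Matrix.mulVec_mulVec, Matrix.mulVec_mulVec,
        Matrix.mul_assoc]
    rw [e, hB, Matrix.one_mulVec, ← real_inner_self_eq_norm_sq,
      EuclideanSpace.inner_eq_star_dotProduct, star_trivial]
  -- Although `B` varies with `N`, the lower bound `c ^ 2` on the covariance form bounds `u`
  -- uniformly in `N`, so each summand is of order `1 / √N`.
  have hua : ∀ a, |u a| ≤ ‖t‖ / c := by
    intro a
    have h1 := le_avgCov_quadForm P hc hP hN u
    rw [hut] at h1
    have h2 : u a ^ 2 ≤ u ⬝ᵥ u := by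
      rw [dotProduct, pow_two]
      exact Finset.single_le_sum (f := fun a => u a * u a) (fun b _ => mul_self_nonneg _)
        (Finset.mem_univ a)
    refine abs_le_of_sq_le_sq ?_ (by positivity)
    rw [div_pow, le_div_iff₀ (by positivity)]
    nlinarith [sq_nonneg c]
  have hsum : ∑ a, |u a| ≤ k * (‖t‖ / c) := by
    refine (Finset.sum_le_sum fun a _ => hua a).trans ?_
    simp
  let X : Fin N → StateSpace k → ℝ := fun i ω => (√N)⁻¹ * centeredComponent P u i (ω i)
  have hXi : iIndepFun X P := by
    have h1 : iIndepFun (fun (i : Fin N) (ω : StateSpace k) => ω i) P :=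
      hindep.precomp Fin.val_injective
    exact h1.comp (fun i s => (√N)⁻¹ * centeredComponent P u i s)
      fun i => measurable_of_finite _
  have hXm : ∀ i, Measurable (X i) := fun i =>
    (measurable_of_finite fun s => (√N)⁻¹ * centeredComponent P u i s).comp
      (measurable_pi_apply (i : ℕ))
  have hXb : ∀ i ω, |X i ω| ≤ k * (‖t‖ / c) / √N := fun i ω => by
    rw [abs_mul, abs_of_nonneg (by positivity : 0 ≤ (√(N : ℝ))⁻¹), mul_comm, ← div_eq_mul_inv]
    gcongr
    exact (abs_centeredComponent_le P u i _).trans hsum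
  have hX0 : ∀ i, ∫ ω, X i ω ∂P = 0 := fun i => by
    simp only [X]
    rw [integral_const_mul, integral_centeredComponent, mul_zero]
  have hX2 : ∑ i, ∫ ω, X i ω ^ 2 ∂P = ‖t‖ ^ 2 := by
    simp only [X, mul_pow]
    simp_rw [integral_const_mul, integral_centeredComponent_sq]
    rw [← Finset.mul_sum, inv_pow, Real.sq_sqrt hN'.le,
      ← Finset.sum_range fun i => u ⬝ᵥ (covMat (marginal P i) *ᵥ u), ← avgCov_quadForm, hut]
  have key := norm_integral_cexp_sum_sub_gaussian_le hXi hXm (by positivity) hNt hXb hX0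
  rw [hX2] at key
  rw [charFun_apply, integral_map (measurable_normalizedSampleMean P B N).aemeasurable
    (by fun_prop)]
  simp_rw [inner_normalizedSampleMean]
  rw [Complex.ofReal_pow] at key
  refine key.trans (le_of_eq ?_)
  have hs : √(N : ℝ) ^ 2 = N := Real.sq_sqrt hN'.le
  have hs0 : √(N : ℝ) ≠ 0 := by positivity
  -- This also rewrites the `N` under the square roots, which `Real.sqrt_sq` then restores.
  conv_lhs => rw [← hs]
  rw [Real.sqrt_sq (by positivity)]
  field_simp

theorem tendsto_charFun_normalizedSampleMean {P : Measure (StateSpace k)}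
    [IsProbabilityMeasure P] (hindep : iIndepFun (fun (i : ℕ) (ω : StateSpace k) => ω i) P)
    {c : ℝ} (hc : 0 < c) (hP : ∀ i s, c ≤ (marginal P i).real {s})
    {B : ℕ → Matrix (Fin k) (Fin k) ℝ} (hB : ∀ N ≠ 0, B N * avgCov P N * (B N)ᵀ = 1)
    (t : EuclideanSpace ℝ (Fin k)) :
    Tendsto (fun N => charFun (P.map (normalizedSampleMean P (B N) N)) t) atTop
      (nhds (Complex.exp (-‖t‖ ^ 2 / 2))) := by
  have hs : Tendsto (fun N : ℕ => (√(N : ℝ))⁻¹) atTop (nhds 0) :=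
    tendsto_inv_atTop_zero.comp (Real.tendsto_sqrt_atTop.comp tendsto_natCast_atTop_atTop)
  rw [tendsto_iff_norm_sub_tendsto_zero]
  refine squeeze_zero' (.of_forall fun _ => norm_nonneg _) ?_
    (by simpa using hs.const_mul (4 * (k * (‖t‖ / c)) ^ 3))
  have h1 : Tendsto (fun N : ℕ => k * (‖t‖ / c) / √(N : ℝ)) atTop (nhds 0) := by
    simpa [div_eq_mul_inv] using hs.const_mul (k * (‖t‖ / c))
  filter_upwards [eventually_ne_atTop 0, h1.eventually (eventually_le_nhds one_pos)] with N hN hNt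
  exact norm_charFun_normalizedSampleMean_sub_le hindep hc hP hN (hB N hN) t hNt

theorem tendsto_measure_acceptanceRegion {P : Measure (StateSpace k)}
    [IsProbabilityMeasure P] (hindep : iIndepFun (fun (i : ℕ) (ω : StateSpace k) => ω i) P)
    {c : ℝ} (hc : 0 < c) (hP : ∀ i s, c ≤ (marginal P i).real {s}) (α : ℝ) :
    Tendsto (fun N => P {ω | samplePart N ω ∈ acceptanceRegion N α P}) atTop
      (nhds (chiSquare k (Set.Iic (chiSquareUpperQuantile k α)))) := by
  -- The empty sample has no covariance to normalize; `B 0` is a dummy.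
  have hex : ∀ N : ℕ, ∃ B : Matrix (Fin k) (Fin k) ℝ, N ≠ 0 →
      (avgCov P N)⁻¹ = Bᵀ * B ∧ B * avgCov P N * Bᵀ = 1 := fun N => by
    by_cases hN : N = 0
    · exact ⟨0, fun h => absurd hN h⟩
    · obtain ⟨B, hB⟩ := exists_inv_eq_transpose_mul_self
        (posDef_of_le_quadForm (isHermitian_avgCov P N) (c := c ^ 2) (by positivity)
          fun u => le_avgCov_quadForm P hc hP hN u)
      exact ⟨B, fun _ => hB⟩
  choose B hB using hex
  set q := chiSquareUpperQuantile k α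
  have hm := fun N => measurable_normalizedSampleMean P (B N) N
  let μ : ℕ → ProbabilityMeasure (EuclideanSpace ℝ (Fin k)) := fun N =>
    ⟨P.map (normalizedSampleMean P (B N) N), Measure.isProbabilityMeasure_map (hm N).aemeasurable⟩
  let ν : ProbabilityMeasure (EuclideanSpace ℝ (Fin k)) := ⟨stdGaussian _, inferInstance⟩
  have hμν : Tendsto μ atTop (nhds ν) := by
    rw [ProbabilityMeasure.tendsto_iff_tendsto_charFun]
    intro t
    have := tendsto_charFun_normalizedSampleMean hindep hc hP (fun N hN => (hB N hN).2) t
    rw [← charFun_stdGaussian] at this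
    exact this
  -- Portmanteau for the ball `‖z‖ ^ 2 ≤ q`, whose preimage is the acceptance event.
  have h := ProbabilityMeasure.tendsto_measure_of_null_frontier_of_tendsto' hμν
    (stdGaussian_frontier_norm_sq_le k q)
  change Tendsto _ _ (nhds (stdGaussian _ _)) at h
  rw [stdGaussian_norm_sq_le] at h
  refine h.congr' ?_
  filter_upwards [eventually_ne_atTop 0] with N hN
  change P.map _ _ = _
  rw [Measure.map_apply (hm N) (measurableSet_le (by fun_prop) measurable_const)]
  congr 1
  ext ω
  simp only [Set.mem_preimage, Set.mem_ofPred_eq, norm_sq_normalizedSampleMean,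
    ← (hB N hN).1, acceptanceRegion]
  rfl

theorem le_liminf_measure_acceptanceRegion {P : Measure (StateSpace k)}
    [IsProbabilityMeasure P] (hindep : iIndepFun (fun (i : ℕ) (ω : StateSpace k) => ω i) P)
    {c : ℝ} (hc : 0 < c) (hP : ∀ i s, c ≤ (marginal P i).real {s}) {α : ℝ} (hα : 0 < α) :
    ENNReal.ofReal (1 - α) ≤
      liminf (fun N => P {ω | samplePart N ω ∈ acceptanceRegion N α P}) atTop := by
  rw [(tendsto_measure_acceptanceRegion hindep hc hP α).liminf_eq]
  exact le_chiSquare_Iic_quantile k hα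

end CentralLimit

/-! ### The two asymptotic levels. -/

theorem accommodates_of_mem {k N : ℕ} {𝒬 : Set (ProbabilityMeasure (StateSpace k))}
    {P : ProbabilityMeasure (StateSpace k)} (hP : P ∈ 𝒬) : Accommodates N 𝒬 P :=
  subset_closure (subset_convexHull _ _ ⟨P, hP, rfl⟩)

theorem theorem5 (k : ℕ) (α : ℝ) (hα0 : 0 < α) (hα1 : α < 1)
    (𝒟 : Set (ProbabilityMeasure (StateSpace k))) (h_init : IsInitialSet 𝒟)
    (hpos : ∀ P ∈ 𝒟, ∃ c : ℝ, 0 < c ∧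
      ∀ (i : ℕ) (s : Fin (k + 1)), c ≤ (marginal (P : Measure (StateSpace k)) i).real {s}) :
    (∀ p : Measure (Fin (k + 1)), IsProbabilityMeasure p → (∀ s, 0 < p {s}) →
      ENNReal.ofReal (1 - α) ≤
        liminf (fun N : ℕ => iidDGP p {ω | samplePart N ω ∈ acceptanceRegion N α (iidDGP p)})
          atTop) ∧
    AccommodatesTruthWithLevel 𝒟 (robustUpdatedSet 𝒟 α) α := by
  constructor
  · intro p hp hpos'
    have hprob : IsProbabilityMeasure (iidDGP p) := by
      unfold iidDGP
      infer_instance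
    -- With finitely many outcomes, the least probability is a positive lower bound valid for every
    -- experiment.
    obtain ⟨s₀, hs₀⟩ := Finite.exists_min fun s => p.real {s}
    refine le_liminf_measure_acceptanceRegion (c := p.real {s₀})
      (iIndepFun_infinitePi (X := fun _ s => s) fun _ => measurable_id)
      (ENNReal.toReal_pos (hpos' s₀).ne' (measure_ne_top _ _)) (fun i s => ?_) hα0
    exact (hs₀ s).trans_eq (congrArg (fun μ => μ.real {s}) (marginal_iidDGP p i).symm)
  · intro P hP
    obtain ⟨c, hc, hPc⟩ := hpos P hP
    refine (le_liminf_measure_acceptanceRegion (h_init.independent P hP) hc hPc hα0).trans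
      (liminf_le_liminf ?_)
    filter_upwards [eventually_ne_atTop 0] with N hN
    exact measure_mono fun ω hω => accommodates_of_mem
      ⟨hP, acceptanceRegion_subset_avgMarginal _ hc hPc hN α hω⟩
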